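/- **Model.** $G=(V,E,\omega)$ is a connected undirected graph with vertex names $V=\{0,\dots,n-1\}$ and edge weights $\omega:E\to\mathbb R_{>0}$. Write $d$ for its shortest-path distance and $D=\max_{u,v}d(u,v)/\min_{u\ne v}d(u,v)$ for its normalized diameter. $B(u,\ell)$ is the set of the $\ell$ vertices closest to $u$ ($u$ included, all of $V$ if $\ell>n$), with ties broken by vertex name. For a fixed constant $\alpha>0$ put $\tilde q=\lceil\alpha q\log_2 n\rceil$. The notation $\tilde O(\cdot)$ hides factors $C(\log_2 n)^{k}$. Routing is in the fixed port model: at each vertex $u$ the incident links are numbered $0,\dots,\deg(u)-1$ in an arbitrary, given order. A routing scheme consists of a local algorithm, which does not depend on the graph, and of a routing table (a bit string) for every vertex. The source computes the initial header (a bit string) from its table and the name of the destination. Every vertex that receives the message computes from its own table and the header alone either that the message is delivered there, or a port and the new header with which the message is forwarded. **Statement.** There is a local algorithm such that the following holds. Let $\mathcal W=\{W_1,\dots,W_q\}$ be a partition of a set $W\subseteq V$ into $q$ (possibly empty) sets, each of size $\tilde O(|W|/q)$. Let $\mathcal U=\{U_1,\dots,U_q\}$ be a partition of $V$ into $q$ sets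 such that $U_i\cap B(u,\tilde q)\neq\emptyset$ for all $1\le i\le q$ and $u\in V$. Then for every $\varepsilon>0$ there are routing tables such that: * for every $1\le i\le q$, every $u\in U_i$ and every $w\in W_i$, a message from $u$ to $w$ is delivered at $w$ along a walk of length at most $(1+\varepsilon)\,d(u,w)$; * every header used on the way has $O\big((1+\tfrac1\varepsilon)\,(1+\log_2 D)\,\log_2 n\big)$ bits, that is, the size of $O((1+\frac1\varepsilon)(1+\log_2 D))$ vertex names; * the routing table of every vertex has $\tilde O\big(q+(1+\tfrac1\varepsilon)(1+\log_2 D)\,|W|/q\big)$ bits. The constant in the header bound is absolute. The constant and the exponent in the table bound depend only on $\alpha$ and on the constant and exponent in the bound $|W_i|=\tilde O(|W|/q)$. -/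

import Mathlib

noncomputable section

/-- A connected undirected graph on the vertex names `0, …, n - 1` with positive real edge weights. -/
structure WeightedGraph (n : ℕ) where
  graph : SimpleGraph (Fin n)
  connected : graph.Connected
  weight : Sym2 (Fin n) → ℝ
  weight_pos : ∀ e ∈ graph.edgeSet, 0 < weight e

namespace WeightedGraph

variable {n : ℕ} (N : WeightedGraph n)

/-- The length of a walk: the sum of the weights of its edges, with multiplicity. -/
def walkLength {u v : Fin n} (p : N.graph.Walk u v) : ℝ :=
  (p.edges.map N.weight).sum

/-- The length of a shortest path. -/
def dist (u v : Fin n) : ℝ :=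
  ⨅ p : N.graph.Walk u v, N.walkLength p

/-- The normalized diameter: the largest distance divided by the smallest distance between
distinct vertices. -/
def normalizedDiameter : ℝ :=
  (⨆ p : Fin n × Fin n, N.dist p.1 p.2) /
    (⨅ p : {p : Fin n × Fin n // p.1 ≠ p.2}, N.dist p.1.1 p.1.2)

/-- The `l` vertices closest to `u` (`u` itself included), ties broken by vertex name:
`v` belongs to it when fewer than `l` vertices precede `v`. -/
def vicinity (u : Fin n) (l : ℕ) : Set (Fin n) :=
  {v | {x : Fin n | N.dist u x < N.dist u v ∨ (N.dist u x = N.dist u v ∧ x < v)}.ncard < l}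

/-- A port numbering (fixed port model): at every vertex `u`, the links to the neighbours of `u`
carry the numbers `0, …, deg u - 1` in some order, over which the routing scheme has no control. -/
def PortNumbering : Type :=
  ∀ u : Fin n, N.graph.neighborSet u ≃ Fin (N.graph.neighborSet u).ncard

end WeightedGraph

/-- The local algorithm of a routing scheme, run at every vertex of every network. All that it knows
about the network is the routing table of the vertex at which it runs.
* `start table w` is the header with which the source, holding `table`, sends a message to the
  vertex named `w`.
* `step table header` is the decision at a vertex holding `table` that has received a message
  carrying `header`: `none` if the message is to be delivered here, and `some (p, header')` if it is
  to be forwarded through port `p` with the header `header'`. -/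
structure LocalRouter where
  start : List Bool → ℕ → List Bool
  step : List Bool → List Bool → Option (ℕ × List Bool)

namespace LocalRouter

variable (R : LocalRouter) {n : ℕ} (N : WeightedGraph n) (port : N.PortNumbering)
  (table : Fin n → List Bool) (H : ℝ)

/-- A message that is at `x` with the header `h` traverses exactly the walk `p` and is delivered at
its end, and its header never has more than `H` bits. -/
def Traverses : {x y : Fin n} → N.graph.Walk x y → List Bool → Prop
  | x, _, .nil, h => (h.length : ℝ) ≤ H ∧ R.step (table x) h = none
  | x, _, .cons (v := z) hxz p, h => (h.length : ℝ) ≤ H ∧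
      ∃ h' : List Bool, R.step (table x) h = some ((port x ⟨z, hxz⟩ : ℕ), h') ∧ Traverses p h'

/-- With the routing tables `table`, a message from `u` to `w` is delivered at `w`, along a walk of
length at most `s` times the distance, with headers of at most `H` bits. -/
def RoutesWithStretch (s : ℝ) (u w : Fin n) : Prop :=
  ∃ p : N.graph.Walk u w,
    R.Traverses N port table H p (R.start (table u) w) ∧ N.walkLength p ≤ s * N.dist u w

end LocalRouter

/-- `P` is a partition of `S` into `q` indexed sets. -/
def IsIndexedPartition {n q : ℕ} (P : Fin q → Finset (Fin n)) (S : Finset (Fin n)) : Prop :=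
  (∀ i j : Fin q, i ≠ j → Disjoint (P i) (P j)) ∧ ∀ v : Fin n, v ∈ S ↔ ∃ i : Fin q, v ∈ P i

end

/-! Every vertex stores a port towards each member of its vicinity, so a message can follow shortest
paths inside vicinities. For each `w` in `W_i`, a vertex `u` of `U_i` also stores a short list of
waypoints: exits from successive vicinities along a shortest path to `w`. The list ends at `w` or at
another vertex of `U_i` nearer to `w`, which supplies the next list.

Put `e = ε / (2 + ε)`, so that `(1 + e) / (1 - e) = 1 + ε`. Suppose the list has reached `x` on the
shortest path, and let `t ∈ U_i` lie in the vicinity of `x`. If `d(x,t) ≤ e d(u,x)`, the list ends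
with a detour to `t`: the cost is at most `(1 + e) d(u,x)`, while the distance to `w` drops by at
least `(1 - e) d(u,x)`. Otherwise the first vertex `z` of the path outside the vicinity is at least
as far from `x` as `t`, so `d(u,z) ≥ (1 + e) d(u,x)`. Such growth is possible only about `log D /
log (1 + e)` times, which bounds the list (`exists_leads_of_dist_lt`, `exists_leads`). The costs of
the successive lists telescope to `(1 + ε) d(u,w)` (`WaypointDelivers.of_forall_leads`). -/

/-! ### Prefix codes and their lengths -/

/-- A self-delimiting code: the code word at the front of a bit string, and what follows it, can be
recovered from the string. -/
def IsPrefixCode {β : Type*} (f : β → List Bool) : Prop :=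
  ∀ a b s t, f a ++ s = f b ++ t → a = b ∧ s = t

theorem IsPrefixCode.injective {β : Type*} {f : β → List Bool} (hf : IsPrefixCode f) :
    Function.Injective f :=
  fun a b h => (hf a b [] [] (by simpa using h)).1

/-- The code of a list: each element is announced by `true`, the end by `false`. -/
def encodeList {β : Type*} (f : β → List Bool) : List β → List Bool
  | [] => [false]
  | a :: l => true :: (f a ++ encodeList f l)

/-- The code of a pair: the two codes one after the other. -/
def encodePair {β γ : Type*} (f : β → List Bool) (g : γ → List Bool) (p : β × γ) : List Bool :=
  f p.1 ++ g p.2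

/-- The code of a natural number: the list of its binary digits. -/
def encodeNat (m : ℕ) : List Bool :=
  encodeList (fun b => [b]) m.bits

theorem isPrefixCode_encodeList {β : Type*} {f : β → List Bool} (hf : IsPrefixCode f) :
    IsPrefixCode (encodeList f) := by
  intro l
  induction l with
  | nil =>
    intro m s t h
    cases m with
    | nil => simpa [encodeList] using h
    | cons b m => simp [encodeList] at h
  | cons a l ih =>
    intro m s t h
    cases m with
    | nil => simp [encodeList] at h
    | cons b m =>
      simp only [encodeList, List.cons_append, List.append_assoc, List.cons.injEq, true_and] at h
      obtain ⟨rfl, h'⟩ := hf _ _ _ _ h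
      obtain ⟨rfl, rfl⟩ := ih _ _ _ h'
      exact ⟨rfl, rfl⟩

theorem isPrefixCode_encodePair {β γ : Type*} {f : β → List Bool} {g : γ → List Bool}
    (hf : IsPrefixCode f) (hg : IsPrefixCode g) : IsPrefixCode (encodePair f g) := by
  rintro ⟨a, b⟩ ⟨a', b'⟩ s t h
  simp only [encodePair, List.append_assoc] at h
  obtain ⟨rfl, h'⟩ := hf _ _ _ _ h
  obtain ⟨rfl, rfl⟩ := hg _ _ _ _ h'
  exact ⟨rfl, rfl⟩

theorem isPrefixCode_encodeNat : IsPrefixCode encodeNat := by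
  intro a b s t h
  have hbit : IsPrefixCode (fun b : Bool => [b]) := by
    intro a b s t h
    simpa using h
  obtain ⟨hab, hst⟩ := isPrefixCode_encodeList hbit _ _ _ _ h
  refine ⟨?_, hst⟩
  rw [← Nat.ofDigits_digits 2 a, ← Nat.ofDigits_digits 2 b, Nat.digits_two_eq_bits,
    Nat.digits_two_eq_bits, hab]

theorem length_encodeList_le {β : Type*} {f : β → List Bool} {c : ℝ} {l : List β}
    (h : ∀ a ∈ l, ((f a).length : ℝ) ≤ c) :
    ((encodeList f l).length : ℝ) ≤ 1 + l.length * (1 + c) := by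
  induction l with
  | nil => simp [encodeList]
  | cons a l ih =>
    have h1 := h a (by simp)
    have h2 := ih fun b hb => h b (by simp [hb])
    simp only [encodeList, List.length_cons, List.length_append]
    push_cast
    linarith

theorem one_le_logb_two {n : ℕ} (hn : 2 ≤ n) : 1 ≤ Real.logb 2 n := by
  rw [Real.le_logb_iff_rpow_le (by norm_num) (by positivity)]
  simpa using (by exact_mod_cast hn : (2 : ℝ) ≤ n)

theorem length_encodeNat_le {m n : ℕ} (hn : 2 ≤ n) (hm : m < n) :
    ((encodeNat m).length : ℝ) ≤ 5 * Real.logb 2 n := by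
  have hlog := one_le_logb_two hn
  have h1 : ((encodeNat m).length : ℝ) ≤ 1 + m.bits.length * (1 + 1) :=
    length_encodeList_le (by simp)
  have h2 : m.size ≤ Nat.log 2 n + 1 :=
    Nat.size_le.2 (hm.trans (Nat.lt_pow_succ_log_self (by norm_num) n))
  have h3 : (Nat.log 2 n : ℝ) ≤ Real.logb 2 n := by
    simpa using Real.natLog_le_logb n 2
  rw [Nat.size_eq_bits_len] at h1
  have h4 : (m.size : ℝ) ≤ Nat.log 2 n + 1 := by exact_mod_cast h2
  -- There are at most `log n + 1` digits of two bits each and one end marker; `1 ≤ log n` absorbs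
  -- the constants.
  linarith

/-! ### Contents and sizes of headers and tables -/

/-- The waypoints on the way to a destination: a sequence of pairs `(y, p)`, each of which says to
go to the vertex named `y` and to leave it through the port `p`. -/
abbrev Waypoints : Type := List (ℕ × ℕ)

/-- The contents of a header: the destination and the remaining waypoints. -/
abbrev HeaderData : Type := ℕ × Waypoints

/-- The contents of a routing table: the name of the vertex, the ports that lead towards the
vertices nearby, and the waypoints for some destinations. -/
abbrev TableData : Type := ℕ × List (ℕ × ℕ) × List (ℕ × Waypoints)

def encodePorts : List (ℕ × ℕ) → List Bool :=
  encodeList (encodePair encodeNat encodeNat)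

def encodeHeader : HeaderData → List Bool :=
  encodePair encodeNat encodePorts

def encodeTable : TableData → List Bool :=
  encodePair encodeNat (encodePair encodePorts (encodeList encodeHeader))

theorem isPrefixCode_encodePorts : IsPrefixCode encodePorts :=
  isPrefixCode_encodeList (isPrefixCode_encodePair isPrefixCode_encodeNat isPrefixCode_encodeNat)

theorem isPrefixCode_encodeHeader : IsPrefixCode encodeHeader :=
  isPrefixCode_encodePair isPrefixCode_encodeNat isPrefixCode_encodePorts

theorem isPrefixCode_encodeTable : IsPrefixCode encodeTable :=
  isPrefixCode_encodePair isPrefixCode_encodeNat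
    (isPrefixCode_encodePair isPrefixCode_encodePorts
      (isPrefixCode_encodeList isPrefixCode_encodeHeader))

theorem length_encodePorts_le {n : ℕ} (hn : 2 ≤ n) {l : List (ℕ × ℕ)}
    (hl : ∀ p ∈ l, p.1 < n ∧ p.2 < n) :
    ((encodePorts l).length : ℝ) ≤ 1 + l.length * (11 * Real.logb 2 n) := by
  have hlog := one_le_logb_two hn
  refine (length_encodeList_le (c := 10 * Real.logb 2 n) fun p hp => ?_).trans ?_
  · have h1 := length_encodeNat_le hn (hl p hp).1
    have h2 := length_encodeNat_le hn (hl p hp).2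
    simp only [encodePair, List.length_append]
    push_cast
    linarith
  · gcongr
    linarith

theorem length_encodeHeader_le {n : ℕ} (hn : 2 ≤ n) {w : ℕ} (hw : w < n) {l : Waypoints}
    (hl : ∀ p ∈ l, p.1 < n ∧ p.2 < n) :
    ((encodeHeader (w, l)).length : ℝ) ≤ 6 * Real.logb 2 n + l.length * (11 * Real.logb 2 n) := by
  have hlog := one_le_logb_two hn
  have h1 := length_encodeNat_le hn hw
  have h2 := length_encodePorts_le hn hl
  simp only [encodeHeader, encodePair, List.length_append]
  push_cast
  linarith

theorem length_encodeTable_le {n : ℕ} (hn : 2 ≤ n) {u : ℕ} (hu : u < n) {l : List (ℕ × ℕ)}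
    (hl : ∀ p ∈ l, p.1 < n ∧ p.2 < n) {r : List (ℕ × Waypoints)} {K : ℝ}
    (hr : ∀ e ∈ r, e.1 < n ∧ (e.2.length : ℝ) ≤ K ∧ ∀ p ∈ e.2, p.1 < n ∧ p.2 < n) :
    ((encodeTable (u, l, r)).length : ℝ) ≤
      (7 + l.length * 11 + r.length * (11 * (K + 1))) * Real.logb 2 n := by
  have hlog := one_le_logb_two hn
  have h1 := length_encodeNat_le hn hu
  have h2 := length_encodePorts_le hn hl
  have h3 : ((encodeList encodeHeader r).length : ℝ) ≤
      1 + r.length * (1 + (6 + K * 11) * Real.logb 2 n) := by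
    refine length_encodeList_le fun e he => ?_
    obtain ⟨he1, he2, he3⟩ := hr e he
    refine (length_encodeHeader_le hn he1 he3).trans ?_
    nlinarith
  have h4 : r.length * (1 + (6 + K * 11) * Real.logb 2 n) ≤
      r.length * (11 * (K + 1) * Real.logb 2 n) := by
    gcongr
    linarith
  simp only [encodeTable, encodePair, List.length_append]
  push_cast
  linarith

/-! ### The local algorithm -/

/-- Forwarding at a vertex with the table `T`, towards the first of the given waypoints. -/
def forward (T : TableData) (w : ℕ) : Waypoints → Option (ℕ × HeaderData)
  | [] => none
  | (y, p) :: l =>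
    if T.1 = y then some (p, (w, l))
    else (T.2.1.lookup y).map fun p' => (p', (w, (y, p) :: l))

/-- The decision at a vertex with the table `T`. When there are no waypoints left, the message is
delivered if this is its destination, and otherwise takes new waypoints from the table. -/
def decision (T : TableData) : HeaderData → Option (ℕ × HeaderData)
  | (w, []) => if T.1 = w then none else forward T w ((T.2.2.lookup w).getD [])
  | (w, e :: l) => forward T w (e :: l)

/-- Routing along waypoints. -/
noncomputable def waypointRouter : LocalRouter where
  -- The source needs no special case: its first step loads the waypoints, as at any later vertex
  -- where a list runs out.
  start _ w := encodeHeader (w, [])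
  step t h :=
    (decision (Function.invFun encodeTable t) (Function.invFun encodeHeader h)).map
      fun r => (r.1, encodeHeader r.2)

theorem waypointRouter_step (T : TableData) (h : HeaderData) :
    waypointRouter.step (encodeTable T) (encodeHeader h) =
      (decision T h).map fun r => (r.1, encodeHeader r.2) := by
  simp only [waypointRouter, Function.leftInverse_invFun isPrefixCode_encodeTable.injective T,
    Function.leftInverse_invFun isPrefixCode_encodeHeader.injective h]

theorem lookup_map_val {n : ℕ} {β : Type*} (f : Fin n → β) {l : List (Fin n)} {v : Fin n}
    (hv : v ∈ l) : (l.map fun x : Fin n => ((x : ℕ), f x)).lookup (v : ℕ) = some (f v) := by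
  induction l with
  | nil => simp at hv
  | cons x l ih =>
    rw [List.map_cons, List.lookup_cons]
    by_cases h : v = x
    · subst h
      simp
    · have h' : ((v : ℕ) == (x : ℕ)) = false := by
        simpa [Fin.ext_iff] using h
      rw [h']
      exact ih (by simpa [h] using hv)

/-- Induction along a real-valued function on the vertices. -/
theorem Fin.induction_on_real {n : ℕ} (f : Fin n → ℝ) {P : Fin n → Prop}
    (h : ∀ x, (∀ y, f y < f x → P y) → P x) (x : Fin n) : P x := by
  have : IsTrans (Fin n) (InvImage (· < ·) f) := ⟨fun _ _ _ hab hbc => lt_trans hab hbc⟩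
  have : Std.Irrefl (InvImage (· < ·) f : Fin n → Fin n → Prop) := ⟨fun a ha => lt_irrefl (f a) ha⟩
  exact (Finite.wellFounded_of_trans_of_irrefl (InvImage (· < ·) f)).induction x h

/-! ### The shortest-path metric -/

namespace WeightedGraph

variable {n : ℕ} (N : WeightedGraph n)

theorem walkLength_nil (x : Fin n) : N.walkLength (.nil : N.graph.Walk x x) = 0 := by
  simp [walkLength]

theorem walkLength_cons {x y z : Fin n} (h : N.graph.Adj x y) (p : N.graph.Walk y z) :
    N.walkLength (.cons h p) = N.weight s(x, y) + N.walkLength p := by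
  simp [walkLength]

theorem weight_pos_of_adj {x y : Fin n} (h : N.graph.Adj x y) : 0 < N.weight s(x, y) :=
  N.weight_pos _ h

theorem walkLength_nonneg {x y : Fin n} (p : N.graph.Walk x y) : 0 ≤ N.walkLength p := by
  induction p with
  | nil => exact (N.walkLength_nil _).ge
  | cons h p ih =>
    rw [walkLength_cons]
    exact add_nonneg (N.weight_pos_of_adj h).le ih

theorem dist_nonneg (x y : Fin n) : 0 ≤ N.dist x y :=
  Real.iInf_nonneg fun p => N.walkLength_nonneg p

theorem dist_le_walkLength {x y : Fin n} (p : N.graph.Walk x y) :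
    N.dist x y ≤ N.walkLength p :=
  ciInf_le ⟨0, by rintro _ ⟨p, rfl⟩; exact N.walkLength_nonneg p⟩ p

/-- Connectedness matters here: an infimum over no walks would be the default value `0`. -/
theorem le_dist {x y : Fin n} {c : ℝ} (h : ∀ p : N.graph.Walk x y, c ≤ N.walkLength p) :
    c ≤ N.dist x y :=
  have : Nonempty (N.graph.Walk x y) := N.connected.preconnected x y
  le_ciInf h

theorem dist_self (x : Fin n) : N.dist x x = 0 :=
  le_antisymm ((N.dist_le_walkLength .nil).trans (N.walkLength_nil x).le) (N.dist_nonneg x x)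

theorem dist_comm (x y : Fin n) : N.dist x y = N.dist y x := by
  have key : ∀ x y, N.dist x y ≤ N.dist y x := fun x y => N.le_dist fun p => by
    have : N.walkLength p.reverse = N.walkLength p := by
      simp [walkLength, List.sum_reverse]
    exact this ▸ N.dist_le_walkLength p.reverse
  exact le_antisymm (key x y) (key y x)

theorem dist_triangle (x y z : Fin n) : N.dist x z ≤ N.dist x y + N.dist y z := by
  rw [← sub_le_iff_le_add]
  refine N.le_dist fun q => ?_
  rw [sub_le_comm]
  refine N.le_dist fun p => ?_
  have h : N.walkLength (q.append p) = N.walkLength q + N.walkLength p := by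
    simp [walkLength]
  linarith [N.dist_le_walkLength (q.append p)]

theorem dist_le_weight {x y : Fin n} (h : N.graph.Adj x y) : N.dist x y ≤ N.weight s(x, y) := by
  simpa [walkLength] using N.dist_le_walkLength (.cons h .nil)

/-- A neighbour on a shortest path. -/
theorem exists_adj_weight_add_dist {x y : Fin n} (hxy : x ≠ y) :
    ∃ z, N.graph.Adj x z ∧ N.weight s(x, z) + N.dist z y = N.dist x y := by
  classical
  have hne : (Finset.univ.filter fun z => N.graph.Adj x z).Nonempty := by
    obtain ⟨p⟩ := N.connected.preconnected x y
    cases p with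
    | nil => exact absurd rfl hxy
    | cons h p => exact ⟨_, by simpa using h⟩
  -- Minimizing over the finitely many neighbours avoids having to show that the infimum over walks
  -- is attained.
  obtain ⟨z, hz, hmin⟩ := Finset.exists_min_image _ (fun z => N.weight s(x, z) + N.dist z y) hne
  have hz : N.graph.Adj x z := by simpa using hz
  refine ⟨z, hz, le_antisymm (N.le_dist fun p => ?_) ?_⟩
  · cases p with
    | nil => exact absurd rfl hxy
    | cons h p =>
      rw [walkLength_cons]
      exact (hmin _ (by simpa using h)).trans (by gcongr; exact N.dist_le_walkLength p)
  · exact (N.dist_triangle x z y).trans (by gcongr; exact N.dist_le_weight hz)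

theorem dist_pos {x y : Fin n} (hxy : x ≠ y) : 0 < N.dist x y := by
  obtain ⟨z, hz, h⟩ := N.exists_adj_weight_add_dist hxy
  linarith [N.weight_pos_of_adj hz, N.dist_nonneg z y]

/-! ### Vicinities -/

/-- The vertex `x` precedes the vertex `v` in the order of the distances from `u`. -/
def Precedes (u x v : Fin n) : Prop :=
  N.dist u x < N.dist u v ∨ (N.dist u x = N.dist u v ∧ x < v)

theorem mem_vicinity_of_imp {u v u' v' : Fin n} {l : ℕ} (hv : v ∈ N.vicinity u l)
    (h : ∀ x, N.Precedes u' x v' → N.Precedes u x v) : v' ∈ N.vicinity u' l :=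
  (Set.ncard_le_ncard h (Set.toFinite _)).trans_lt hv

theorem Precedes.trans {u x y z : Fin n} (h : N.Precedes u x y) (h' : N.Precedes u y z) :
    N.Precedes u x z := by
  rcases h with h | ⟨h, hx⟩ <;> rcases h' with h' | ⟨h', hy⟩
  · exact .inl (h.trans h')
  · exact .inl (h.trans_eq h')
  · exact .inl (h.trans_lt h')
  · exact .inr ⟨h.trans h', hx.trans hy⟩

theorem mem_vicinity_of_precedes {u x v : Fin n} {l : ℕ} (hv : v ∈ N.vicinity u l)
    (h : N.Precedes u x v) : x ∈ N.vicinity u l :=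
  N.mem_vicinity_of_imp hv fun _ hy => Precedes.trans N hy h

theorem mem_vicinity_of_dist_lt {u x v : Fin n} {l : ℕ} (hv : v ∈ N.vicinity u l)
    (h : N.dist u x < N.dist u v) : x ∈ N.vicinity u l :=
  N.mem_vicinity_of_precedes hv (.inl h)

theorem dist_le_of_mem_of_not_mem_vicinity {u x v : Fin n} {l : ℕ} (hv : v ∈ N.vicinity u l)
    (hx : x ∉ N.vicinity u l) : N.dist u v ≤ N.dist u x :=
  le_of_not_gt fun h => hx (N.mem_vicinity_of_dist_lt hv h)

theorem self_mem_vicinity {u v : Fin n} {l : ℕ} (hv : v ∈ N.vicinity u l) :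
    u ∈ N.vicinity u l := by
  by_cases h : u = v
  · exact h ▸ hv
  · exact N.mem_vicinity_of_dist_lt hv (by rw [dist_self]; exact N.dist_pos h)

/-- Vicinities are closed under moving along a shortest path. -/
theorem mem_vicinity_of_dist_add {u x v : Fin n} {l : ℕ} (hv : v ∈ N.vicinity u l)
    (h : N.dist u x + N.dist x v = N.dist u v) : v ∈ N.vicinity x l := by
  -- By the triangle inequality, whatever precedes `v` as seen from `x` also precedes it as seen
  -- from `u`; ties keep the same name order.
  refine N.mem_vicinity_of_imp hv fun y hy => ?_
  have htri := N.dist_triangle u x y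
  rcases hy with hy | ⟨hy, hlt⟩
  · exact .inl (by linarith)
  · rcases lt_or_eq_of_le (show N.dist u y ≤ N.dist u v by linarith) with h' | h'
    · exact .inl h'
    · exact .inr ⟨h', hlt⟩

/-- `Precedes` is a strict total order, so the number of predecessors is an injective rank, with
values below `l` on the vicinity. -/
theorem ncard_vicinity_le (u : Fin n) (l : ℕ) : (N.vicinity u l).ncard ≤ l := by
  have hmono : ∀ x y, N.Precedes u x y →
      {z | N.Precedes u z x}.ncard < {z | N.Precedes u z y}.ncard := by
    intro x y hxy
    refine Set.ncard_lt_ncard ⟨fun z hz => Precedes.trans N hz hxy, fun hsub => ?_⟩ (Set.toFinite _)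
    rcases hsub hxy with h | h
    · exact lt_irrefl _ h
    · exact lt_irrefl _ h.2
  have hinj : Set.InjOn (fun v => {z | N.Precedes u z v}.ncard) (N.vicinity u l) := by
    intro x _ y _ hxy
    by_contra hne
    have : N.Precedes u x y ∨ N.Precedes u y x := by
      rcases lt_trichotomy (N.dist u x) (N.dist u y) with h | h | h
      · exact .inl (.inl h)
      · rcases lt_or_gt_of_ne hne with h' | h'
        · exact .inl (.inr ⟨h, h'⟩)
        · exact .inr (.inr ⟨h.symm, h'⟩)
      · exact .inr (.inl h)
    rcases this with h | h
    · exact (hmono _ _ h).ne hxy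
    · exact (hmono _ _ h).ne hxy.symm
  have h := Set.ncard_le_ncard_of_injOn (s := N.vicinity u l) (t := Set.Iio l)
    (fun v => {z | N.Precedes u z v}.ncard) (fun v hv => hv) hinj (Set.finite_Iio l)
  rwa [Set.ncard_eq_toFinset_card' (Set.Iio l), Set.toFinset_Iio, Nat.card_Iio] at h

/-- The last edge of a shortest path to a vertex in the vicinity. -/
theorem exists_adj_of_mem_vicinity {x t : Fin n} {l : ℕ} (ht : t ∈ N.vicinity x l) (hxt : x ≠ t) :
    ∃ y ∈ N.vicinity x l, N.graph.Adj y t ∧ N.dist x y + N.weight s(y, t) = N.dist x t := by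
  obtain ⟨y, hy, h⟩ := N.exists_adj_weight_add_dist hxt.symm
  rw [N.dist_comm y, N.dist_comm t, Sym2.eq_swap] at h
  refine ⟨y, N.mem_vicinity_of_dist_lt ht ?_, hy.symm, by linarith⟩
  linarith [Sym2.eq_swap (a := t) (b := y) ▸ N.weight_pos_of_adj hy]

/-- The first edge of a shortest path that leaves the vicinity. -/
theorem exists_adj_not_mem_vicinity {x w : Fin n} {l : ℕ} (hx : x ∈ N.vicinity x l)
    (hw : w ∉ N.vicinity x l) :
    ∃ y ∈ N.vicinity x l, ∃ z ∉ N.vicinity x l, N.graph.Adj y z ∧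
      N.dist x y + N.weight s(y, z) = N.dist x z ∧ N.dist x z + N.dist z w = N.dist x w := by
  have key : ∀ v, v ∈ N.vicinity x l → N.dist x v + N.dist v w = N.dist x w →
      ∃ y ∈ N.vicinity x l, ∃ z ∉ N.vicinity x l, N.graph.Adj y z ∧
        N.dist x y + N.weight s(y, z) = N.dist x z ∧ N.dist x z + N.dist z w = N.dist x w := by
    -- Advance along a shortest path while still inside the vicinity; the distance to `w` decreases.
    refine Fin.induction_on_real (N.dist · w) fun v ih hv hvw => ?_
    obtain ⟨z, hz, h⟩ := N.exists_adj_weight_add_dist (x := v) (y := w)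
      (fun h => hw (h ▸ hv))
    have h1 := N.dist_triangle x v z
    have h2 := N.dist_triangle x z w
    have h3 := N.dist_le_weight hz
    have h4 := N.weight_pos_of_adj hz
    by_cases hzv : z ∈ N.vicinity x l
    · exact ih z (by linarith) hzv (by linarith)
    · exact ⟨v, hv, z, hzv, hz, by linarith, by linarith⟩
  exact key x hx (by rw [dist_self, zero_add])

/-! ### The normalized diameter -/

theorem iInf_dist_pos {u w : Fin n} (huw : u ≠ w) :
    0 < ⨅ p : {p : Fin n × Fin n // p.1 ≠ p.2}, N.dist p.1.1 p.1.2 := by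
  have : Nonempty {p : Fin n × Fin n // p.1 ≠ p.2} := ⟨⟨(u, w), huw⟩⟩
  obtain ⟨p, hp⟩ := exists_eq_ciInf_of_finite
    (f := fun p : {p : Fin n × Fin n // p.1 ≠ p.2} => N.dist p.1.1 p.1.2)
  exact hp ▸ N.dist_pos p.2

/-- This caps the geometric growth: no distance exceeds any positive one by more than the factor
`D`. -/
theorem dist_le_normalizedDiameter_mul {u w : Fin n} (huw : u ≠ w) (x y : Fin n) :
    N.dist x y ≤ N.normalizedDiameter * N.dist u w := by
  have hpos := N.iInf_dist_pos huw
  have h1 : N.dist x y ≤ ⨆ p : Fin n × Fin n, N.dist p.1 p.2 :=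
    le_ciSup (f := fun p : Fin n × Fin n => N.dist p.1 p.2) (Set.finite_range _).bddAbove (x, y)
  have h2 : ⨅ p : {p : Fin n × Fin n // p.1 ≠ p.2}, N.dist p.1.1 p.1.2 ≤ N.dist u w :=
    ciInf_le (f := fun p : {p : Fin n × Fin n // p.1 ≠ p.2} => N.dist p.1.1 p.1.2)
      (Set.finite_range _).bddBelow ⟨(u, w), huw⟩
  rw [normalizedDiameter, div_mul_eq_mul_div, le_div_iff₀ hpos]
  exact mul_le_mul h1 h2 hpos.le ((N.dist_nonneg x y).trans h1)

theorem one_le_normalizedDiameter {u w : Fin n} (huw : u ≠ w) : 1 ≤ N.normalizedDiameter := by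
  have h := N.dist_le_normalizedDiameter_mul huw u w
  exact le_of_mul_le_mul_right (by simpa using h) (N.dist_pos huw)

end WeightedGraph

/-! ### Waypoint lists and routing tables -/

namespace WeightedGraph

variable {n : ℕ} (N : WeightedGraph n) (port : N.PortNumbering)

/-- The waypoints `L` lead from `x` to `t` along a walk of length `c`, each of them lying in the
vicinity of the vertex at which it becomes the next one. -/
inductive Leads (l : ℕ) : Fin n → Waypoints → Fin n → ℝ → Prop
  | nil (x : Fin n) : Leads l x [] x 0
  | cons {x y z t : Fin n} {L : Waypoints} {c : ℝ} (hy : y ∈ N.vicinity x l)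
      (h : N.graph.Adj y z) (hL : Leads l z L t c) :
      Leads l x (((y : ℕ), (port y ⟨z, h⟩ : ℕ)) :: L) t (N.dist x y + N.weight s(y, z) + c)

variable {N port}

theorem port_lt {x z : Fin n} (h : N.graph.Adj x z) : (port x ⟨z, h⟩ : ℕ) < n :=
  (port x ⟨z, h⟩).isLt.trans_le <| by
    simpa using Set.ncard_le_card (N.graph.neighborSet x)

theorem Leads.lt {l : ℕ} {x t : Fin n} {L : Waypoints} {c : ℝ} (h : N.Leads port l x L t c) :
    ∀ p ∈ L, p.1 < n ∧ p.2 < n := by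
  induction h with
  | nil => simp
  | cons hy h hL ih =>
    intro p hp
    rcases List.mem_cons.1 hp with rfl | hp
    · exact ⟨Fin.isLt _, port_lt h⟩
    · exact ih p hp

/-- A single waypoint leads to any vertex of the vicinity. -/
theorem exists_leads_of_mem_vicinity {l : ℕ} {x t : Fin n} (ht : t ∈ N.vicinity x l) :
    ∃ L, N.Leads port l x L t (N.dist x t) ∧ L.length ≤ 1 := by
  by_cases hxt : x = t
  · subst hxt
    exact ⟨[], by rw [dist_self]; exact .nil x, by simp⟩
  · obtain ⟨y, hy, hadj, h⟩ := N.exists_adj_of_mem_vicinity ht hxt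
    exact ⟨_, by simpa [h] using Leads.cons hy hadj (.nil t), by simp⟩

/-- A message that is under way from `u` to `w` and has come to `x` can go on to `w`, or to a vertex
of `U` from where the waypoints to `w` are known. -/
theorem exists_leads_of_dist_lt {l : ℕ} {U : Set (Fin n)}
    (hU : ∀ x, ∃ t ∈ U, t ∈ N.vicinity x l) {u w : Fin n} {e b : ℝ} (he : 0 < e) (he1 : e < 1)
    (hb : ∀ x, N.dist u x < b) (m : ℕ) :
    ∀ x, 0 < N.dist u x → N.dist u x + N.dist x w = N.dist u w → b ≤ N.dist u x * (1 + e) ^ m →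
      ∃ L t c, N.Leads port l x L t c ∧ L.length ≤ m ∧ (t = w ∨ t ∈ U) ∧
        (N.dist u x + c) * (1 - e) ≤ (1 + e) * (N.dist u w - N.dist t w) ∧
        N.dist t w < N.dist u w := by
  induction m with
  | zero =>
    intro x _ _ hx
    exact absurd (hb x) (by simpa using hx)
  | succ m ih =>
    intro x hx hxw hbx
    -- `b` exceeds every distance from `u`, so the hypothesis on `b` leaves room for fewer than `m`
    -- more growths by the factor `1 + e`; with `m = 0` it is contradictory.
    obtain ⟨t, htU, ht⟩ := hU x
    have hxx := N.self_mem_vicinity ht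
    have hxw0 := N.dist_nonneg x w
    by_cases hw : w ∈ N.vicinity x l
    · obtain ⟨L, hL, hlen⟩ := exists_leads_of_mem_vicinity (port := port) hw
      refine ⟨L, w, _, hL, by omega, .inl rfl, ?_, ?_⟩
      · rw [dist_self, hxw]
        nlinarith
      · rw [dist_self]
        linarith
    by_cases hxt : N.dist x t ≤ e * N.dist u x
    · obtain ⟨L, hL, hlen⟩ := exists_leads_of_mem_vicinity (port := port) ht
      have htri := N.dist_triangle t x w
      rw [N.dist_comm t x] at htri
      have hxt0 := N.dist_nonneg x t
      refine ⟨L, t, _, hL, by omega, .inr htU, ?_, ?_⟩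
      · have h1 : N.dist u x - N.dist x t ≤ N.dist u w - N.dist t w := by linarith
        have h2 := mul_le_mul_of_nonneg_left h1 (by linarith : 0 ≤ 1 + e)
        nlinarith
      · nlinarith
    · obtain ⟨y, hy, z, hz, hadj, hyz, hzw⟩ := N.exists_adj_not_mem_vicinity hxx hw
      -- The vicinity contains `t`, so its radius exceeds `e * N.dist u x`, and leaving it
      -- multiplies the distance from `u` by at least `1 + e`.
      have h1 := N.dist_le_of_mem_of_not_mem_vicinity ht hz
      have h2 := N.dist_triangle u x z
      have h3 := N.dist_triangle u z w
      have huz : N.dist u z = N.dist u x + N.dist x z := by linarith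
      have hgrow : N.dist u x * (1 + e) ≤ N.dist u z := by linarith
      have hpow : 0 ≤ (1 + e) ^ m := by positivity
      obtain ⟨L, t', c, hL, hlen, ht', hc, hlt⟩ := ih z (by linarith [N.dist_nonneg x z])
        (by linarith) (by
          rw [pow_succ'] at hbx
          nlinarith [mul_le_mul_of_nonneg_right hgrow hpow])
      refine ⟨_, t', _, .cons hy hadj hL, by simpa using hlen, ht', ?_, hlt⟩
      rw [hyz, ← add_assoc, ← huz]
      exact hc

/-- The waypoints stored at `u` for the destination `w`. -/
theorem exists_leads {l : ℕ} {U : Set (Fin n)} (hU : ∀ x, ∃ t ∈ U, t ∈ N.vicinity x l)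
    {u w : Fin n} (huw : u ≠ w) {ε : ℝ} (hε : 0 < ε) {m : ℕ}
    (hm : N.normalizedDiameter < (1 + ε / (2 + ε)) ^ m) :
    ∃ L t c, N.Leads port l u L t c ∧ L.length ≤ m + 1 ∧ (t = w ∨ t ∈ U) ∧
      c ≤ (1 + ε) * (N.dist u w - N.dist t w) ∧ N.dist t w < N.dist u w := by
  obtain ⟨t₀, -, ht₀⟩ := hU u
  by_cases hw : w ∈ N.vicinity u l
  · obtain ⟨L, hL, hlen⟩ := exists_leads_of_mem_vicinity (port := port) hw
    have hpos := N.dist_pos huw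
    refine ⟨L, w, _, hL, by omega, .inl rfl, ?_, ?_⟩ <;> rw [dist_self]
    · nlinarith
    · exact hpos
  -- Growth needs a positive starting distance, so the first exit `z` is taken unconditionally; it
  -- is the extra one in `m + 1`.
  · obtain ⟨y, hy, z, hz, hadj, hyz, hzw⟩ :=
      N.exists_adj_not_mem_vicinity (N.self_mem_vicinity ht₀) hw
    have huz : u ≠ z := fun h => hz (h ▸ N.self_mem_vicinity ht₀)
    have hpos := N.dist_pos huz
    have he : 0 < ε / (2 + ε) := by positivity
    have he1 : ε / (2 + ε) < 1 := by
      rw [div_lt_one (by positivity)]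
      linarith
    obtain ⟨L, t, c, hL, hlen, ht, hc, hlt⟩ := exists_leads_of_dist_lt (port := port) (u := u)
      (b := N.dist u z * (1 + ε / (2 + ε)) ^ m) hU he he1
      (fun x => (N.dist_le_normalizedDiameter_mul huz u x).trans_lt
        (by rw [mul_comm]; exact mul_lt_mul_of_pos_left hm hpos)) m z hpos hzw le_rfl
    refine ⟨_, t, _, .cons hy hadj hL, by simpa using hlen, ht, ?_, hlt⟩
    rw [hyz]
    have h1 : 1 - ε / (2 + ε) = 2 / (2 + ε) := by field_simp; ring
    have h2 : 1 + ε / (2 + ε) = 2 / (2 + ε) * (1 + ε) := by field_simp; ring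
    rw [h1, h2, mul_comm, mul_assoc] at hc
    exact le_of_mul_le_mul_left hc (by positivity)

variable (N port)

open Classical in
/-- A port of `x` that leads to `v` along a shortest path. -/
noncomputable def portTowards (x v : Fin n) : ℕ :=
  -- An arbitrary value, stored but never used: `forward` first tests whether the waypoint is the
  -- current vertex.
  if h : x = v then 0
  else port x ⟨(N.exists_adj_weight_add_dist h).choose,
    (N.exists_adj_weight_add_dist h).choose_spec.1⟩

theorem exists_portTowards {x v : Fin n} (hxv : x ≠ v) :
    ∃ z, ∃ h : N.graph.Adj x z, N.portTowards port x v = (port x ⟨z, h⟩ : ℕ) ∧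
      N.weight s(x, z) + N.dist z v = N.dist x v :=
  ⟨_, (N.exists_adj_weight_add_dist hxv).choose_spec.1, by rw [portTowards, dif_neg hxv],
    (N.exists_adj_weight_add_dist hxv).choose_spec.2⟩

theorem portTowards_lt (x v : Fin n) : N.portTowards port x v < n := by
  by_cases h : x = v
  · rw [portTowards, dif_pos h]
    exact x.pos
  · obtain ⟨z, hz, h, -⟩ := N.exists_portTowards port h
    exact h ▸ port_lt hz

/-- The routing table of `u`, for waypoints `way` to the destinations `dest`. -/
noncomputable def tableData (l : ℕ) (dest : Fin n → Finset (Fin n))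
    (way : Fin n → Fin n → Waypoints) (u : Fin n) : TableData :=
  (u, (N.vicinity u l).toFinite.toFinset.toList.map fun v : Fin n => ((v : ℕ), N.portTowards port u v),
    (dest u).toList.map fun w : Fin n => ((w : ℕ), way u w))

theorem length_encodeTable_tableData_le (hn : 2 ≤ n) (l : ℕ) (dest : Fin n → Finset (Fin n))
    (way : Fin n → Fin n → Waypoints) (u : Fin n) {K : ℝ}
    (hway : ∀ w ∈ dest u, ((way u w).length : ℝ) ≤ K ∧ ∀ p ∈ way u w, p.1 < n ∧ p.2 < n) :
    ((encodeTable (N.tableData port l dest way u)).length : ℝ) ≤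
      (7 + l * 11 + (dest u).card * (11 * (K + 1))) * Real.logb 2 n := by
  have hlog := one_le_logb_two hn
  refine (length_encodeTable_le hn u.isLt ?_ ?_ (K := K)).trans ?_
  · intro p hp
    obtain ⟨v, -, rfl⟩ := List.mem_map.1 hp
    exact ⟨v.isLt, N.portTowards_lt port u v⟩
  · intro e he
    obtain ⟨w, hw, rfl⟩ := List.mem_map.1 he
    exact ⟨w.isLt, hway w (by simpa using hw)⟩
  · have h : ((N.vicinity u l).toFinite.toFinset.card : ℝ) ≤ l := by
      rw [← Set.ncard_eq_toFinset_card]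
      exact_mod_cast N.ncard_vicinity_le u l
    rw [List.length_map, List.length_map, Finset.length_toList, Finset.length_toList]
    gcongr

end WeightedGraph

/-! ### Delivery of messages -/

namespace LocalRouter

variable (R : LocalRouter) {n : ℕ} (N : WeightedGraph n) (port : N.PortNumbering)
  (table : Fin n → List Bool) (H : ℝ)

/-- A message that is at `x` with the header `h` is delivered at `w` along a walk of length at most
`c`. -/
def Delivers (x w : Fin n) (h : List Bool) (c : ℝ) : Prop :=
  ∃ p : N.graph.Walk x w, R.Traverses N port table H p h ∧ N.walkLength p ≤ c

variable {R N port table H}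

theorem Delivers.mono {x w : Fin n} {h : List Bool} {c c' : ℝ}
    (hd : R.Delivers N port table H x w h c) (hc : c ≤ c') :
    R.Delivers N port table H x w h c' :=
  hd.imp fun _ hp => ⟨hp.1, hp.2.trans hc⟩

theorem Delivers.of_step_eq_none {w : Fin n} {h : List Bool} (hh : (h.length : ℝ) ≤ H)
    (hs : R.step (table w) h = none) : R.Delivers N port table H w w h 0 :=
  ⟨.nil, by rw [Traverses]; exact ⟨hh, hs⟩, (N.walkLength_nil w).le⟩

theorem Delivers.cons {x z w : Fin n} {h h' : List Bool} {c : ℝ} (hh : (h.length : ℝ) ≤ H)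
    (hxz : N.graph.Adj x z) (hs : R.step (table x) h = some ((port x ⟨z, hxz⟩ : ℕ), h'))
    (hd : R.Delivers N port table H z w h' c) :
    R.Delivers N port table H x w h (N.weight s(x, z) + c) := by
  obtain ⟨p, hp, hc⟩ := hd
  refine ⟨.cons hxz p, by rw [Traverses]; exact ⟨hh, h', hs, hp⟩, ?_⟩
  rw [N.walkLength_cons]
  gcongr

/-- Headers on which the algorithm takes the same decision are interchangeable. -/
theorem Delivers.of_step_eq {x w : Fin n} {h h' : List Bool} {c : ℝ} (hh : (h.length : ℝ) ≤ H)
    (hs : R.step (table x) h = R.step (table x) h') (hd : R.Delivers N port table H x w h' c) :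
    R.Delivers N port table H x w h c := by
  obtain ⟨p, hp, hc⟩ := hd
  refine ⟨p, ?_, hc⟩
  cases p with
  | nil =>
    rw [Traverses] at hp ⊢
    exact ⟨hh, hs ▸ hp.2⟩
  | cons hxz p =>
    rw [Traverses] at hp ⊢
    exact ⟨hh, hs ▸ hp.2⟩

end LocalRouter

/-! ### Correctness of waypoint routing -/

namespace WeightedGraph

variable {n : ℕ} {N : WeightedGraph n} {port : N.PortNumbering} {l : ℕ}
  {dest : Fin n → Finset (Fin n)} {way : Fin n → Fin n → Waypoints} {H : ℝ} {w : Fin n}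

/-- The delivery of a message to `w` by the router that follows waypoints. -/
abbrev WaypointDelivers (port : N.PortNumbering) (l : ℕ) (dest : Fin n → Finset (Fin n))
    (way : Fin n → Fin n → Waypoints) (H : ℝ) (w x : Fin n) (L : Waypoints) (c : ℝ) : Prop :=
  waypointRouter.Delivers N port (fun u => encodeTable (N.tableData port l dest way u)) H x w
    (encodeHeader ((w : ℕ), L)) c

/-- Routing to the next waypoint and beyond. -/
theorem WaypointDelivers.cons {y z : Fin n} (hadj : N.graph.Adj y z) {L : Waypoints} {c : ℝ}
    (hH : ((encodeHeader ((w : ℕ), ((y : ℕ), (port y ⟨z, hadj⟩ : ℕ)) :: L)).length : ℝ) ≤ H)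
    (hd : WaypointDelivers port l dest way H w z L c) {x : Fin n} (hy : y ∈ N.vicinity x l) :
    WaypointDelivers port l dest way H w x
      (((y : ℕ), (port y ⟨z, hadj⟩ : ℕ)) :: L) (N.dist x y + N.weight s(y, z) + c) := by
  induction x using Fin.induction_on_real (N.dist · y) with | h x ih => ?_
  by_cases hxy : x = y
  · subst hxy
    rw [dist_self, zero_add]
    refine LocalRouter.Delivers.cons hH hadj ?_ hd
    rw [waypointRouter_step]
    simp [decision, forward, tableData]
  · obtain ⟨x', hx', hport, hdist⟩ := N.exists_portTowards port hxy
    have h1 := N.weight_pos_of_adj hx'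
    have h2 := N.dist_triangle x x' y
    have h3 := N.dist_le_weight hx'
    -- The next vertex also has `y` in its own vicinity, so its table has a port towards `y`.
    have hd' := ih x' (by linarith) (N.mem_vicinity_of_dist_add hy (by linarith))
    refine (LocalRouter.Delivers.cons hH hx' ?_ hd').mono (by linarith)
    rw [waypointRouter_step]
    have hlook := lookup_map_val (fun v => N.portTowards port x v)
      (l := (N.vicinity x l).toFinite.toFinset.toList) (v := y) (by simpa using hy)
    have hne : (x : ℕ) ≠ y := fun h => hxy (Fin.ext h)
    simp only [decision, forward, tableData, if_neg hne, hlook, hport, Option.map_some]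

theorem WaypointDelivers.of_leads {x t : Fin n} {L : Waypoints} {c c' : ℝ} {K : ℕ}
    (hH : ∀ L : Waypoints, L.length ≤ K → (∀ p ∈ L, p.1 < n ∧ p.2 < n) →
      ((encodeHeader ((w : ℕ), L)).length : ℝ) ≤ H)
    (hL : N.Leads port l x L t c) (hlen : L.length ≤ K)
    (hd : WaypointDelivers port l dest way H w t [] c') :
    WaypointDelivers port l dest way H w x L (c + c') := by
  induction hL with
  | nil x => simpa using hd
  | cons hy h hL ih =>
    have hlt := (Leads.cons hy h hL).lt
    rw [add_assoc]
    exact WaypointDelivers.cons h (hH _ hlen hlt)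
      (ih (by simp only [List.length_cons] at hlen; omega) hd) hy

/-- An exhausted list and the stored one give the same decision at `x`. The stored list must be
nonempty, or the header `(w, way x w)` would itself trigger a lookup. -/
theorem WaypointDelivers.of_way {x : Fin n} {c : ℝ} (hxw : x ≠ w) (hw : w ∈ dest x)
    (hH : ((encodeHeader ((w : ℕ), [])).length : ℝ) ≤ H) (hne : way x w ≠ [])
    (hd : WaypointDelivers port l dest way H w x (way x w) c) :
    WaypointDelivers port l dest way H w x [] c := by
  refine LocalRouter.Delivers.of_step_eq hH ?_ hd
  have hlook := lookup_map_val (fun v => way x v) (l := (dest x).toList) (v := w) (by simpa using hw)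
  have hne' : (x : ℕ) ≠ w := fun h => hxw (Fin.ext h)
  rw [waypointRouter_step, waypointRouter_step]
  obtain ⟨e, L, hL⟩ := List.exists_cons_of_ne_nil hne
  simp only [decision, tableData, if_neg hne', hlook, Option.getD_some, hL]

/-- Routing with stretch `1 + ε` from the vertices of `U` to `w`. -/
theorem WaypointDelivers.of_forall_leads {U : Set (Fin n)} {K : ℕ} {ε : ℝ}
    (hH : ∀ L : Waypoints, L.length ≤ K → (∀ p ∈ L, p.1 < n ∧ p.2 < n) →
      ((encodeHeader ((w : ℕ), L)).length : ℝ) ≤ H)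
    (hdest : ∀ u ∈ U, w ∈ dest u)
    (hway : ∀ u ∈ U, u ≠ w → (way u w).length ≤ K ∧ ∃ t c, N.Leads port l u (way u w) t c ∧
      (t = w ∨ t ∈ U) ∧ c ≤ (1 + ε) * (N.dist u w - N.dist t w) ∧ N.dist t w < N.dist u w)
    {u : Fin n} (hu : u ∈ U) :
    WaypointDelivers port l dest way H w u [] ((1 + ε) * N.dist u w) := by
  have hH0 : ((encodeHeader ((w : ℕ), [])).length : ℝ) ≤ H := hH [] (by simp) (by simp)
  have hself : WaypointDelivers port l dest way H w w [] ((1 + ε) * N.dist w w) := by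
    rw [dist_self, mul_zero]
    refine LocalRouter.Delivers.of_step_eq_none hH0 ?_
    rw [waypointRouter_step]
    simp [decision, tableData]
  -- Each list ends strictly nearer to `w` and costs at most `1 + ε` times the progress made, so the
  -- sum telescopes.
  induction u using Fin.induction_on_real (N.dist · w) with | h u ih => ?_
  by_cases huw : u = w
  · exact huw ▸ hself
  · obtain ⟨hlen, t, c, hL, ht, hc, hlt⟩ := hway u hu huw
    have hd : WaypointDelivers port l dest way H w t [] ((1 + ε) * N.dist t w) :=
      ht.elim (fun h => h ▸ hself) (ih t hlt)
    refine WaypointDelivers.of_way huw (hdest u hu) hH0 (fun h => ?_)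
      ((WaypointDelivers.of_leads hH hL hlen hd).mono (by linarith))
    rw [h] at hL
    cases hL
    exact lt_irrefl _ hlt

end WeightedGraph

/-! ### Choice of parameters and the theorem -/

/-- The number of steps in which a quantity that grows by the factor `1 + ε / (2 + ε)` exceeds
`D`. -/
theorem exists_nat_lt_one_add_pow {D ε : ℝ} (hD : 1 ≤ D) (hε : 0 < ε) :
    ∃ m : ℕ, D < (1 + ε / (2 + ε)) ^ m ∧
      ((m + 1 : ℕ) : ℝ) ≤ 2 * ((1 + 1 / ε) * (1 + Real.logb 2 D)) := by
  have he : 0 < ε / (2 + ε) := by positivity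
  have he1 : ε / (2 + ε) ≤ 1 := by
    rw [div_le_one (by positivity)]
    linarith
  have hlog : 0 ≤ Real.logb 2 D := Real.logb_nonneg (by norm_num) hD
  -- Bernoulli's inequality for exponents in `[0, 1]`: any `m > log D / e` suffices, and `1 / e = 1
  -- + 2 / ε`.
  have hbase : (2 : ℝ) ^ (ε / (2 + ε)) ≤ 1 + ε / (2 + ε) := by
    have h := rpow_one_add_le_one_add_mul_self (s := 1) (by norm_num) he.le he1
    norm_num at h
    exact h
  refine ⟨⌊Real.logb 2 D / (ε / (2 + ε))⌋₊ + 1, ?_, ?_⟩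
  · have h1 := Nat.lt_floor_add_one (Real.logb 2 D / (ε / (2 + ε)))
    rw [div_lt_iff₀ he] at h1
    calc D = 2 ^ Real.logb 2 D := (Real.rpow_logb (by norm_num) (by norm_num) (by linarith)).symm
      _ < 2 ^ ((⌊Real.logb 2 D / (ε / (2 + ε))⌋₊ + 1 : ℝ) * (ε / (2 + ε))) :=
        Real.rpow_lt_rpow_of_exponent_lt (by norm_num) h1
      _ = ((2 : ℝ) ^ (ε / (2 + ε))) ^ (⌊Real.logb 2 D / (ε / (2 + ε))⌋₊ + 1) := by
        rw [mul_comm, Real.rpow_mul (by norm_num), ← Real.rpow_natCast]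
        push_cast
        rfl
      _ ≤ _ := by gcongr
  · have h1 := Nat.floor_le (div_nonneg hlog he.le)
    have h2 : Real.logb 2 D / (ε / (2 + ε)) = (1 + 2 * (1 / ε)) * Real.logb 2 D := by
      field_simp
      ring
    rw [h2] at h1
    have h3 : 0 < 1 / ε := by positivity
    push_cast
    rw [h2]
    nlinarith

theorem mainTheorem6 :
    ∃ (R : LocalRouter) (C₁ : ℝ), ∀ (α A : ℝ) (a : ℕ), 0 < α →
      ∃ (C₂ : ℝ) (k : ℕ),
        ∀ (n q : ℕ) (N : WeightedGraph n) (port : N.PortNumbering)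
          (W : Finset (Fin n)) (Wpart Upart : Fin q → Finset (Fin n)),
          IsIndexedPartition Wpart W →
          (∀ i : Fin q, ((Wpart i).card : ℝ) ≤
            A * Real.logb 2 n ^ a * ((W.card : ℝ) / (q : ℝ))) →
          IsIndexedPartition Upart Finset.univ →
          (∀ (i : Fin q) (u : Fin n),
            ∃ v ∈ Upart i, v ∈ N.vicinity u ⌈α * (q : ℝ) * Real.logb 2 n⌉₊) →
          ∀ ε : ℝ, 0 < ε →
            ∃ table : Fin n → List Bool,
              (∀ u : Fin n, ((table u).length : ℝ) ≤
                C₂ * Real.logb 2 n ^ k *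
                  ((q : ℝ) + (1 + 1 / ε) * (1 + Real.logb 2 N.normalizedDiameter) *
                    ((W.card : ℝ) / (q : ℝ)))) ∧
              ∀ (i : Fin q), ∀ u ∈ Upart i, ∀ w ∈ Wpart i,
                R.RoutesWithStretch N port table
                  (C₁ * ((1 + 1 / ε) * (1 + Real.logb 2 N.normalizedDiameter) * Real.logb 2 n))
                  (1 + ε) u w := by
  -- `28 = 6 + 2 * 11`, from lists of at most `2 * S` waypoints. In the table constant, `18 = 7 +
  -- 11` includes the rounding in `l`, and `33` comes from `2 * S + 1 ≤ 3 * S`; `A` may be negative.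
  refine ⟨waypointRouter, 28, fun α A a hα => ⟨18 + 11 * α + 33 * |A|, a + 2, ?_⟩⟩
  intro n q N port W Wpart Upart _ hWcard hUpart hU ε hε
  rcases Nat.eq_zero_or_pos n with rfl | hn0
  · exact ⟨fun _ => [], fun u => u.elim0, fun _ u => u.elim0⟩
  choose idx hidx using fun u => (hUpart.2 u).1 (Finset.mem_univ u)
  have hidx_eq : ∀ i, ∀ u ∈ Upart i, idx u = i := fun i u hu => by
    by_contra hne
    exact Finset.disjoint_left.1 (hUpart.1 _ _ hne) (hidx u) hu
  -- For `n = 1` the logarithm vanishes, so vicinities have size `0` and cannot meet the sets of the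
  -- partition.
  have hn : 2 ≤ n := by
    by_contra hlt
    obtain rfl : n = 1 := by omega
    obtain ⟨v, -, hv⟩ := hU (idx 0) 0
    simp [WeightedGraph.vicinity] at hv
  have hq : 1 ≤ q := (idx ⟨0, hn0⟩).pos
  have hq' : (1 : ℝ) ≤ q := by exact_mod_cast hq
  have hlog := one_le_logb_two hn
  have hD : 1 ≤ N.normalizedDiameter :=
    N.one_le_normalizedDiameter (u := ⟨0, hn0⟩) (w := ⟨1, hn⟩) (by simp)
  obtain ⟨m, hm, hmS⟩ := exists_nat_lt_one_add_pow hD hε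
  set S := (1 + 1 / ε) * (1 + Real.logb 2 N.normalizedDiameter) with hS
  have hS1 : 1 ≤ S := one_le_mul_of_one_le_of_one_le (by simp [hε.le])
    (by simp [Real.logb_nonneg one_lt_two hD])
  set l := ⌈α * (q : ℝ) * Real.logb 2 n⌉₊ with hl
  have hway : ∀ u w : Fin n, ∃ L : Waypoints, L.length ≤ m + 1 ∧
      (∀ p ∈ L, p.1 < n ∧ p.2 < n) ∧ (u ≠ w → ∃ t c, N.Leads port l u L t c ∧
        (t = w ∨ t ∈ (Upart (idx u) : Set (Fin n))) ∧
        c ≤ (1 + ε) * (N.dist u w - N.dist t w) ∧ N.dist t w < N.dist u w) := by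
    intro u w
    by_cases huw : u = w
    · exact ⟨[], by simp, by simp, fun h => absurd huw h⟩
    · obtain ⟨L, t, c, hL, hlen, h⟩ := WeightedGraph.exists_leads (port := port)
        (U := (Upart (idx u) : Set (Fin n))) (fun x => hU (idx u) x) huw hε hm
      exact ⟨L, hlen, hL.lt, fun _ => ⟨t, c, hL, h⟩⟩
  choose way hlen hlt hleads using hway
  have hlen' : ∀ u w, ((way u w).length : ℝ) ≤ 2 * S := fun u w =>
    le_trans (by exact_mod_cast hlen u w) hmS
  refine ⟨fun u => encodeTable (N.tableData port l (fun u => Wpart (idx u)) way u),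
    fun u => ?_, fun i u hu w hw => ?_⟩
  · refine (N.length_encodeTable_tableData_le port hn l _ way u (K := 2 * S)
      fun w _ => ⟨hlen' u w, hlt u w⟩).trans ?_
    set lg := Real.logb 2 n with hlg
    have hceil : (l : ℝ) ≤ α * q * lg + 1 := (Nat.ceil_lt_add_one (by positivity)).le
    set r := (W.card : ℝ) / q with hr
    have hr0 : 0 ≤ r := by positivity
    have hW : ((Wpart (idx u)).card : ℝ) ≤ |A| * lg ^ a * r :=
      (hWcard _).trans (by gcongr; exact le_abs_self A)
    have hpa : 1 ≤ lg ^ a := one_le_pow₀ hlog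
    calc (7 + l * 11 + (Wpart (idx u)).card * (11 * (2 * S + 1))) * lg
        ≤ (7 * (q * lg) + (α * q * lg + q * lg) * 11 + |A| * lg ^ a * r * (11 * (3 * S))) * lg := by
          have hql : 1 ≤ q * lg := one_le_mul_of_one_le_of_one_le hq' hlog
          gcongr <;> linarith
      _ = (18 + 11 * α) * lg ^ 2 * q + 33 * |A| * lg ^ (a + 1) * (S * r) := by ring
      _ ≤ (18 + 11 * α + 33 * |A|) * lg ^ (a + 2) * q +
          (18 + 11 * α + 33 * |A|) * lg ^ (a + 2) * (S * r) := by
          have hA := abs_nonneg A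
          gcongr ?_ * ?_ * _ + ?_ * ?_ * _
          · linarith
          · exact pow_le_pow_right₀ hlog (by omega)
          · linarith
          · exact pow_le_pow_right₀ hlog (by omega)
      _ = _ := by ring
  · have hH : ∀ L : Waypoints, L.length ≤ m + 1 → (∀ p ∈ L, p.1 < n ∧ p.2 < n) →
        ((encodeHeader ((w : ℕ), L)).length : ℝ) ≤ 28 * (S * Real.logb 2 n) := by
      intro L hL hLlt
      have hL' : (L.length : ℝ) ≤ 2 * S := le_trans (by exact_mod_cast hL) hmS
      refine (length_encodeHeader_le hn w.isLt hLlt).trans ?_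
      nlinarith
    refine WeightedGraph.WaypointDelivers.of_forall_leads (U := (Upart i : Set (Fin n))) hH
      (fun v hv => ?_) (fun v hv hvw => ⟨hlen v w, ?_⟩) hu
    · rw [hidx_eq i v hv]
      exact hw
    · have h := hleads v w hvw
      rwa [hidx_eq i v hv] at h
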